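/- **Replica obstruction for the multipartite information of free fermions.** *Setting.* For $k>0$ let $K_k(x,y)=\frac{\sin k(x-y)}{\pi(x-y)}$ for integers $x\ne y$ and $K_k(x,x)=k/\pi$ (the two-point function of the free-fermion ground state on the chain $\mathbb Z$ with Fermi momentum $k$). For a finite set of sites $s\subset\mathbb Z$ let $C_s=(K_k(x,y))_{x,y\in s}$ and define its Rényi-$\alpha$ entropy as $$S^{(\alpha)}_s(k)=\operatorname{Tr}h_\alpha(C_s),\qquad h_\alpha(\lambda)=\frac{\ln(\lambda^\alpha+(1-\lambda)^\alpha)}{1-\alpha}\ (\alpha\neq1),\qquad h_1(\lambda)=-\lambda\ln\lambda-(1-\lambda)\ln(1-\lambda).$$ Let $m$ adjacent strips (consecutive intervals of sites) have positive integer widths $w_1,\dots,w_m$. For a non-empty set $X$ of strips let $S_X^{(\alpha)}$ be the entropy of their union. Fix a reference width $\ell>0$, put $z=k\ell$, and define $$I_m^{(\alpha)}(z)=\sum_{\emptyset\ne X\subseteq\{1,\dots,m\}}(-1)^{|X|+1}S_X^{(\alpha)}(z/\ell).$$ *Statement.* Let $m\ge3$. There are integers $\beta_m(n)\ge m$ ($n=2,3,\dots$),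 depending only on $m$ and $n$, such that for all widths $w_1,\dots,w_m$ and every $\ell>0$ there are constants $c\neq0$ and $C_n\ne0$ ($n\ge2$) with the following properties as $z\to0^+$ (where $f\sim g$ means $f-g=o(g)$): 1. $I_m^{(1)}(z)\sim c\,z$. 2. For every integer $n\ge2$, $$I_m^{(n)}(z)\sim C_n z^{\beta_m(n)},\qquad \frac{I_m^{(n)}(z)}{I_m^{(1)}(z)}\sim\frac{C_n}{c}\,z^{\beta_m(n)-1},\qquad \frac{I_m^{(n)}(z)}{I_m^{(1)}(z)}\longrightarrow0 .$$ 3. (The leading von Neumann signal is not recovered from the leading terms of the integer Rényi data.) For every finite set $N$ of integers $n\ge2$ and every function $\Phi:\mathbb R^N\to\mathbb R$ with $\Phi(x)=O(\|x\|)$ as $x\to0$ (for instance any linear combination), $$\Phi\big((C_nz^{\beta_m(n)})_{n\in N}\big)=o\big(I_m^{(1)}(z)\big)\qquad\text{and}\qquad \Phi\big((I_m^{(n)}(z))_{n\in N}\big)=o\big(I_m^{(1)}(z)\big).$$ -/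

import Mathlib

open Filter Topology Asymptotics

noncomputable section

namespace FreeFermion

/-- The lattice sine kernel: the two-point function `⟨c†_x c_y⟩` of the free-fermion ground state
on the chain `ℤ` with Fermi momentum `k`. -/
def sineKernel (k : ℝ) (x y : ℤ) : ℝ :=
  if x = y then k / Real.pi
  else Real.sin (k * ((x : ℝ) - (y : ℝ))) / (Real.pi * ((x : ℝ) - (y : ℝ)))

/-- The correlation matrix of a finite set of sites `s`. -/
def correlationMatrix (k : ℝ) (s : Finset ℤ) : Matrix s s ℝ :=
  Matrix.of fun x y => sineKernel k x y

theorem sineKernel_comm (k : ℝ) (x y : ℤ) : sineKernel k x y = sineKernel k y x := by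
  unfold sineKernel
  by_cases h : x = y
  · subst h; rfl
  · rw [if_neg h, if_neg (Ne.symm h)]
    have e : (y : ℝ) - (x : ℝ) = -((x : ℝ) - (y : ℝ)) := by ring
    rw [e, mul_neg, mul_neg, Real.sin_neg, neg_div_neg_eq]

theorem correlationMatrix_isHermitian (k : ℝ) (s : Finset ℤ) :
    (correlationMatrix k s).IsHermitian := by
  ext x y
  simp only [Matrix.conjTranspose_apply, correlationMatrix, Matrix.of_apply, star_trivial]
  exact sineKernel_comm k y x

/-- The single-mode Rényi-`α` entropy function
`h_α(t) = ln (t^α + (1 - t)^α) / (1 - α)`, with `h_1(t) = -t ln t - (1 - t) ln (1 - t)`. -/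
def entropyFn (α t : ℝ) : ℝ :=
  if α = 1 then -t * Real.log t - (1 - t) * Real.log (1 - t)
  else Real.log (t ^ α + (1 - t) ^ α) / (1 - α)

/-- The Rényi-`α` entropy `Tr h_α(C_s)` of a finite set of sites `s`: the sum of `h_α` over the
eigenvalues (with multiplicity) of the correlation matrix. -/
def entropy (α k : ℝ) (s : Finset ℤ) : ℝ :=
  ∑ i : s, entropyFn α ((correlationMatrix_isHermitian k s).eigenvalues i)

/-- The sites of the `i`-th of `m` adjacent strips with widths `w 0, …, w (m - 1)`, laid out
consecutively from the origin. -/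
def strip {m : ℕ} (w : Fin m → ℕ) (i : Fin m) : Finset ℤ :=
  Finset.Ico (∑ j ∈ Finset.univ.filter (fun j => j < i), (w j : ℤ))
    ((∑ j ∈ Finset.univ.filter (fun j => j < i), (w j : ℤ)) + (w i : ℤ))

/-- The union of the strips with labels in `X`. -/
def block {m : ℕ} (w : Fin m → ℕ) (X : Finset (Fin m)) : Finset ℤ :=
  X.biUnion (strip w)

/-- The `m`-partite Rényi-`α` information at Fermi momentum `k`:
`∑_{∅ ≠ X} (-1)^(|X| + 1) S_X^(α)`. -/
def multipartiteInfo {m : ℕ} (w : Fin m → ℕ) (α k : ℝ) : ℝ :=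
  ∑ X ∈ (Finset.univ : Finset (Finset (Fin m))).erase ∅,
    (-1 : ℝ) ^ (X.card + 1) * entropy α k (block w X)

/-- The `m`-partite information as a function of `z = k ℓ`, where `ℓ` is the reference width
(the common width if all strips are equal). -/
def infoOfZ {m : ℕ} (w : Fin m → ℕ) (ℓ α z : ℝ) : ℝ :=
  multipartiteInfo w α (z / ℓ)

end FreeFermion

end

/-!
Every entropy is the trace of a function of the correlation matrix `C_s` of a set of sites, and as
`k → 0` the matrix `(π / k) C_s` converges to the all-ones matrix, whose eigenvalues are `|s|` and
`0` (`tendsto_trace_pow_div`, `tendsto_rescaled_eigenvalues`).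

For an integer `n ≥ 2` the function `h_n` is analytic at `0`. The traces of `C_s ^ j` with `j < m`
cancel exactly in the alternating sum over sets of strips: expanding the trace into closed paths
through the strips, a path with fewer than `m` steps misses a strip
(`alternating_sum_trace_pow_eq_zero`). For `j ≥ m` the alternating sum of `|s| ^ j` is, up to sign,
a sum over surjections of products of widths, hence nonzero (`alternating_sum_pow_ne_zero`).
So `β` is the first exponent `≥ m` whose Taylor coefficient in `h_n` does not vanish. Such an
exponent exists because `h_n` is not a polynomial near `0` (`entropyFn_not_polynomial`); it may
exceed `m`, as the coefficients of `h_n` can vanish.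

For `α = 1` the logarithmic singularity of `h_1` at `0` defeats the cancellation. Up to terms
proportional to `|s|`, which cancel, the entropy is `-(k / π) |s| log |s| + o(k)`
(`entropy_one_isLittleO`), and the alternating sum of `|s| log |s|` is an `m`-th mixed difference
of `x log x`, whose `m`-th derivative has no zero on `(0, ∞)` (`alternating_sum_mul_log_ne_zero`).
Hence the von Neumann information is of order `z` and the Rényi informations are of order at least
`z ^ m`.
-/

namespace FreeFermion

/-! ### Alternating sums of powers -/

theorem sum_neg_one_pow_card_of_superset {ι : Type*} [Fintype ι] [DecidableEq ι] (Y : Finset ι) :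
    ∑ X : Finset ι, (if Y ⊆ X then (-1 : ℤ) ^ X.card else 0)
      = if Y = Finset.univ then (-1) ^ Fintype.card ι else 0 := by
  -- Expand `∏ i, (-1 + [i ∉ Y])` over subsets; the factors with `i ∉ Y` are zero.
  have h := Finset.prod_add (fun _ : ι => (-1 : ℤ)) (fun i => if i ∈ Y then 0 else 1) Finset.univ
  have h1 : ∀ X : Finset ι, (∏ _i ∈ X, (-1 : ℤ)) * ∏ i ∈ Finset.univ \ X, (if i ∈ Y then 0 else 1)
      = if Y ⊆ X then (-1 : ℤ) ^ X.card else 0 := by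
    intro X
    rw [Finset.prod_const]
    split_ifs with hYX
    · rw [Finset.prod_eq_one, mul_one]
      intro i hi
      have : i ∉ Y := fun hY => (Finset.mem_sdiff.mp hi).2 (hYX hY)
      simp [this]
    · obtain ⟨i, hiY, hiX⟩ := Finset.not_subset.mp hYX
      rw [Finset.prod_eq_zero (i := i) (by simp [hiX]) (by simp [hiY]), mul_zero]
  simp only [Finset.powerset_univ, h1] at h
  rw [← h]
  split_ifs with hY
  · subst hY; simp
  · obtain ⟨i, hi⟩ : ∃ i, i ∉ Y := by
      by_contra! hc; exact hY (Finset.eq_univ_iff_forall.mpr hc)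
    exact Finset.prod_eq_zero (Finset.mem_univ i) (by simp [hi])

/-- Expanding the power into words, a word that misses a letter is cancelled in the alternating
sum, so only the words using every letter survive. -/
theorem alternating_sum_pow {ι R : Type*} [Fintype ι] [DecidableEq ι] [Ring R] (A : ι → R)
    (j : ℕ) :
    ∑ X : Finset ι, (-1 : ℤ) ^ X.card • (∑ i ∈ X, A i) ^ j
      = (-1 : ℤ) ^ Fintype.card ι • ∑ f : Fin j → ι,
          if Function.Surjective f then (List.ofFn fun l => A (f l)).prod else 0 := by
  classical
  have expand : ∀ X : Finset ι, (∑ i ∈ X, A i) ^ j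
      = ∑ f : Fin j → ι, if Finset.univ.image f ⊆ X then (List.ofFn fun l => A (f l)).prod
        else 0 := by
    intro X
    have h := (MultilinearMap.mkPiAlgebraFin ℤ j R).map_sum_finset (fun _ i => A i) (fun _ => X)
    simp only [MultilinearMap.mkPiAlgebraFin_apply, List.ofFn_const, List.prod_replicate] at h
    rw [h, ← Finset.sum_filter]
    refine Finset.sum_congr ?_ fun _ _ => rfl
    ext f
    simp [Fintype.mem_piFinset, Finset.image_subset_iff]
  simp only [expand, Finset.smul_sum]
  rw [Finset.sum_comm]
  refine Finset.sum_congr rfl fun f _ => ?_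
  have e : ∀ X : Finset ι, (-1 : ℤ) ^ X.card • (if Finset.univ.image f ⊆ X then
      (List.ofFn fun l => A (f l)).prod else 0)
      = (if Finset.univ.image f ⊆ X then (-1 : ℤ) ^ X.card else 0) •
        (List.ofFn fun l => A (f l)).prod := by
    intro X; split_ifs <;> simp
  simp only [e]
  rw [← Finset.sum_smul, sum_neg_one_pow_card_of_superset]
  have : Finset.univ.image f = Finset.univ ↔ Function.Surjective f :=
    by simp [Finset.eq_univ_iff_forall, Function.Surjective]
  simp only [this]
  split_ifs <;> simp

theorem alternating_sum_pow_eq_zero {ι R : Type*} [Fintype ι] [DecidableEq ι] [Ring R] (A : ι → R)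
    {j : ℕ} (hj : j < Fintype.card ι) :
    ∑ X : Finset ι, (-1 : ℤ) ^ X.card • (∑ i ∈ X, A i) ^ j = 0 := by
  rw [alternating_sum_pow, Finset.sum_eq_zero, smul_zero]
  intro f _
  rw [if_neg]
  intro hf
  have := Fintype.card_le_of_surjective f hf
  simp at this
  omega

/-- Up to sign, the sum is a sum of positive products over the surjections from `Fin j`. -/
theorem alternating_sum_pow_ne_zero {ι : Type*} [Fintype ι] [DecidableEq ι] [Nonempty ι]
    (w : ι → ℝ) (hw : ∀ i, 0 < w i) {j : ℕ} (hj : Fintype.card ι ≤ j) :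
    ∑ X : Finset ι, (-1 : ℝ) ^ X.card * (∑ i ∈ X, w i) ^ j ≠ 0 := by
  have h := alternating_sum_pow w j
  simp only [zsmul_eq_mul, Int.cast_pow, Int.cast_neg, Int.cast_one, List.prod_ofFn] at h
  rw [h]
  refine mul_ne_zero (by simp) (ne_of_gt ?_)
  have nonneg : ∀ f : Fin j → ι,
      0 ≤ if Function.Surjective f then ∏ l, w (f l) else 0 := by
    intro f
    split_ifs
    · exact Finset.prod_nonneg fun l _ => (hw _).le
    · exact le_rfl
  obtain ⟨e⟩ : Nonempty (ι ↪ Fin j) :=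
    Function.Embedding.nonempty_of_card_le (by simpa using hj)
  refine Finset.sum_pos' (fun f _ => nonneg f)
    ⟨Function.invFun e, Finset.mem_univ _, ?_⟩
  rw [if_pos (Function.invFun_surjective e.injective)]
  exact Finset.prod_pos fun l _ => hw _

/-! ### Mixed differences of `x log x` -/

/-- Mean value theorem for mixed finite differences: the alternating sum of `F 0` over the sub-sums
of the steps `w i` is the product of the steps times a value of the derivative of the same order.
Differentiability is needed only on `(0, ∞)`, so that the base point may be `0`. -/
theorem exists_alternating_sum_eq_derivative {ι : Type*} [DecidableEq ι] (w : ι → ℝ)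
    (hw : ∀ i, 0 < w i) (s : Finset ι) :
    ∀ (F : ℕ → ℝ → ℝ) (x : ℝ), 0 ≤ x → (∀ j y, 0 < y → HasDerivAt (F j) (F (j + 1) y) y) →
      ContinuousOn (F 0) (Set.Ici x) →
      ∃ ξ, x ≤ ξ ∧ (s.Nonempty → x < ξ) ∧
        ∑ X ∈ s.powerset, (-1 : ℝ) ^ X.card * F 0 (x + ∑ i ∈ X, w i)
          = (-1) ^ s.card * (∏ i ∈ s, w i) * F s.card ξ := by
  induction s using Finset.induction_on with
  | empty => intro F x _ _ _; exact ⟨x, le_rfl, by simp, by simp⟩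
  | insert a s ha ih =>
    intro F x hx hF hc
    set G : (ℝ → ℝ) → ℝ → ℝ := fun f y =>
      ∑ X ∈ s.powerset, (-1 : ℝ) ^ X.card * f (y + ∑ i ∈ X, w i) with hG
    have hnn : ∀ X : Finset ι, 0 ≤ ∑ i ∈ X, w i := fun X =>
      Finset.sum_nonneg fun i _ => (hw i).le
    have hcont : ContinuousOn (G (F 0)) (Set.Icc x (x + w a)) := by
      refine continuousOn_finsetSum _ fun X _ => ContinuousOn.mul continuousOn_const ?_
      refine hc.comp (by fun_prop) fun y hy => ?_
      have := hnn X
      have := hy.1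
      simp only [Set.mem_Ici]; linarith
    have hder : ∀ y ∈ Set.Ioo x (x + w a), HasDerivAt (G (F 0)) (G (F 1) y) y := by
      intro y hy
      refine HasDerivAt.fun_sum fun X _ => HasDerivAt.const_mul _ ?_
      have := hnn X
      have := hy.1
      exact (hF 0 (y + ∑ i ∈ X, w i) (by linarith)).comp_add_const y _
    obtain ⟨y, hy, hyeq⟩ := exists_hasDerivAt_eq_slope (G (F 0)) (G (F 1))
      (by linarith [hw a]) hcont hder
    obtain ⟨ξ, hξ, -, hval⟩ := ih (fun j => F (j + 1)) y (by linarith [hy.1])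
      (fun j => hF (j + 1)) (fun t ht =>
        (hF 1 t (by linarith [hy.1, Set.mem_Ici.mp ht])).continuousAt.continuousWithinAt)
    refine ⟨ξ, by linarith [hy.1], fun _ => by linarith [hy.1], ?_⟩
    rw [Finset.sum_powerset_insert ha]
    have e : ∑ X ∈ s.powerset, (-1 : ℝ) ^ (insert a X).card * F 0 (x + ∑ i ∈ insert a X, w i)
        = - G (F 0) (x + w a) := by
      rw [hG, ← Finset.sum_neg_distrib]
      refine Finset.sum_congr rfl fun X hX => ?_
      have haX : a ∉ X := fun h => ha (Finset.mem_powerset.mp hX h)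
      rw [Finset.card_insert_of_notMem haX, Finset.sum_insert haX, pow_succ, ← add_assoc]
      ring
    have e2 : G (F 1) y = (-1) ^ s.card * (∏ i ∈ s, w i) * F (s.card + 1) ξ := hval
    rw [e, Finset.card_insert_of_notMem ha, Finset.prod_insert ha]
    have hwa : x + w a - x ≠ 0 := by have := hw a; linarith
    rw [e2, eq_div_iff hwa] at hyeq
    change G (F 0) x + _ = _
    rw [pow_succ]
    linear_combination hyeq

/-- The successive derivatives of `x log x` on `(0, ∞)`. -/
noncomputable def mulLogDeriv : ℕ → ℝ → ℝ
  | 0, x => x * Real.log x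
  | 1, x => Real.log x + 1
  | j + 2, x => (-1) ^ j * j.factorial / x ^ (j + 1)

theorem hasDerivAt_mulLogDeriv (j : ℕ) {x : ℝ} (hx : 0 < x) :
    HasDerivAt (mulLogDeriv j) (mulLogDeriv (j + 1) x) x := by
  match j with
  | 0 => exact Real.hasDerivAt_mul_log hx.ne'
  | 1 =>
    have h := (Real.hasDerivAt_log hx.ne').add_const 1
    refine HasDerivAt.congr_deriv (f := fun y => Real.log y + 1) h ?_
    simp [mulLogDeriv]
  | j + 2 =>
    have h := ((hasDerivAt_pow (j + 1) x).inv (pow_ne_zero _ hx.ne')).const_mul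
      ((-1 : ℝ) ^ j * j.factorial)
    refine (h.congr_deriv ?_)
    change _ = (-1 : ℝ) ^ (j + 1) * ((j + 1).factorial : ℝ) / x ^ (j + 1 + 1)
    rw [Nat.factorial_succ]
    push_cast
    field_simp
    ring

/-- The `m`-th derivative of `x log x` has no zero on `(0, ∞)` for `m ≥ 2`, so the mixed difference
cannot vanish. -/
theorem alternating_sum_mul_log_ne_zero {ι : Type*} [Fintype ι] [DecidableEq ι] (w : ι → ℝ)
    (hw : ∀ i, 0 < w i) (hι : 2 ≤ Fintype.card ι) :
    ∑ X : Finset ι, (-1 : ℝ) ^ X.card * ((∑ i ∈ X, w i) * Real.log (∑ i ∈ X, w i)) ≠ 0 := by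
  obtain ⟨ξ, -, hξ, h⟩ := exists_alternating_sum_eq_derivative w hw Finset.univ mulLogDeriv 0 le_rfl
    (fun j y hy => hasDerivAt_mulLogDeriv j hy) (Real.continuous_mul_log.continuousOn)
  have hne : (Finset.univ : Finset ι).Nonempty := by
    rw [← Finset.card_pos, Finset.card_univ]; omega
  have hpos := hξ hne
  simp only [zero_add, Finset.powerset_univ] at h
  change ∑ X : Finset ι, (-1 : ℝ) ^ X.card * ((∑ i ∈ X, w i) * Real.log (∑ i ∈ X, w i)) = _ at h
  rw [h, Finset.card_univ]
  obtain ⟨j, hj⟩ := Nat.exists_eq_add_of_le' hι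
  rw [hj]
  refine mul_ne_zero (mul_ne_zero (by simp) (Finset.prod_ne_zero_iff.mpr fun i _ => (hw i).ne')) ?_
  simp only [mulLogDeriv]
  have := Nat.factorial_ne_zero j
  positivity

/-! ### Traces of powers of the correlation matrix -/

theorem trace_pow_eq_sum_eigenvalues_pow {n : Type*} [Fintype n] [DecidableEq n]
    {A : Matrix n n ℝ} (hA : A.IsHermitian) (j : ℕ) :
    (A ^ j).trace = ∑ i, hA.eigenvalues i ^ j := by
  conv_lhs => rw [hA.spectral_theorem, ← map_pow, Unitary.conjStarAlgAut_apply,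
    Matrix.trace_mul_comm, ← mul_assoc]
  simp [Matrix.diagonal_pow, Matrix.trace_diagonal]

theorem trace_mul_pow_succ_comm {n p R : Type*} [Fintype n] [DecidableEq n] [Fintype p]
    [DecidableEq p] [CommRing R] (A : Matrix n p R) (B : Matrix p n R) (j : ℕ) :
    ((A * B) ^ (j + 1)).trace = ((B * A) ^ (j + 1)).trace := by
  have h : ∀ l : ℕ, (A * B) ^ (l + 1) = A * ((B * A) ^ l * B) := by
    intro l
    induction l with
    | zero => simp
    | succ l ih => rw [pow_succ', ih, pow_succ' (B * A) l]; simp only [Matrix.mul_assoc]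
  rw [h, Matrix.trace_mul_comm, pow_succ, Matrix.mul_assoc]

/-- The traces of powers of the correlation matrix of a subset, written on the larger set of sites
with the coordinate projection of the subset: `C_s = Vᵀ C_U V` for the inclusion `V`. -/
theorem trace_correlationMatrix_pow_succ (k : ℝ) {s U : Finset ℤ} (h : s ⊆ U) (j : ℕ) :
    (correlationMatrix k s ^ (j + 1)).trace
      = ((correlationMatrix k U * Matrix.diagonal fun u : U => if (u : ℤ) ∈ s then 1 else 0)
          ^ (j + 1)).trace := by
  let V : Matrix U s ℝ := Matrix.of fun u x => if (u : ℤ) = x then 1 else 0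
  have hV : V * V.transpose = Matrix.diagonal fun u : U => if (u : ℤ) ∈ s then 1 else 0 := by
    ext u v
    rw [Matrix.mul_apply, Matrix.diagonal_apply]
    simp only [V, Matrix.transpose_apply, Matrix.of_apply, mul_ite, mul_one, mul_zero]
    by_cases hu : (u : ℤ) ∈ s
    · rw [Finset.sum_eq_single ⟨u, hu⟩]
      · by_cases huv : u = v
        · subst huv; simp [hu]
        · have : (v : ℤ) ≠ u := fun e => huv (Subtype.ext e.symm)
          simp [huv, this]
      · intro x _ hx
        have : (u : ℤ) ≠ x := fun e => hx (Subtype.ext e.symm)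
        simp [this]
      · simp
    · rw [Finset.sum_eq_zero]
      · simp [hu]
      · intro x _
        have : (u : ℤ) ≠ x := fun e => hu (e ▸ x.2)
        simp [this]
  have hC : correlationMatrix k s = V.transpose * (correlationMatrix k U * V) := by
    ext x y
    rw [Matrix.mul_apply, Finset.sum_eq_single ⟨x, h x.2⟩, Matrix.mul_apply,
      Finset.sum_eq_single ⟨y, h y.2⟩]
    · simp [V, correlationMatrix]
    · intro u _ hu
      have : (u : ℤ) ≠ y := fun e => hu (Subtype.ext e)
      simp [V, this]
    · simp
    · intro u _ hu
      have : (u : ℤ) ≠ x := fun e => hu (Subtype.ext e)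
      simp [V, this]
    · simp
  rw [hC, trace_mul_pow_succ_comm, Matrix.mul_assoc, hV]

/-! ### Strips and alternating sums over them -/

section Strips

variable {m : ℕ} (w : Fin m → ℕ)

theorem strip_disjoint {i j : Fin m} (hij : i ≠ j) : Disjoint (strip w i) (strip w j) := by
  wlog h : i < j generalizing i j
  · exact (this hij.symm (lt_of_le_of_ne (not_lt.mp h) hij.symm)).symm
  have hsub : insert i (Finset.univ.filter fun l => l < i) ⊆ Finset.univ.filter fun l => l < j := by
    intro l hl
    rcases Finset.mem_insert.mp hl with rfl | hl
    · simpa using h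
    · simpa using lt_trans (Finset.mem_filter.mp hl).2 h
  have hle := Finset.sum_le_sum_of_subset_of_nonneg (f := fun l => (w l : ℤ)) hsub
    fun _ _ _ => Int.natCast_nonneg _
  rw [Finset.sum_insert (by simp)] at hle
  rw [Finset.disjoint_left]
  intro x hx hx'
  have h1 := (Finset.mem_Ico.mp hx).2
  have h2 := (Finset.mem_Ico.mp hx').1
  omega

theorem card_block (X : Finset (Fin m)) : (block w X).card = ∑ i ∈ X, w i := by
  rw [block, Finset.card_biUnion fun i _ j _ hij => strip_disjoint w hij]
  simp [strip]

theorem ite_mem_block (X : Finset (Fin m)) (u : ℤ) :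
    (if u ∈ block w X then 1 else 0 : ℝ) = ∑ i ∈ X, if u ∈ strip w i then 1 else 0 := by
  split_ifs with h
  · obtain ⟨i, hi, hu⟩ := Finset.mem_biUnion.mp h
    rw [Finset.sum_eq_single_of_mem i hi, if_pos hu]
    intro j _ hj
    exact if_neg (Finset.disjoint_left.mp (strip_disjoint w hj.symm) hu)
  · refine (Finset.sum_eq_zero fun i hi => if_neg fun hu => h ?_).symm
    exact Finset.mem_biUnion.mpr ⟨i, hi, hu⟩

theorem alternating_sum_card_block (hm : 2 ≤ m) :
    ∑ X : Finset (Fin m), (-1 : ℝ) ^ X.card * ((block w X).card : ℝ) = 0 := by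
  have h := alternating_sum_pow_eq_zero (fun i : Fin m => (w i : ℝ)) (j := 1)
    (by rw [Fintype.card_fin]; omega)
  simpa [card_block] using h

/-- A trace of fewer than `m` factors of the correlation matrix cannot visit all `m` strips, so it
drops out of the multipartite information. -/
theorem alternating_sum_trace_pow_eq_zero (hm : 2 ≤ m) (k : ℝ) {j : ℕ} (hj : j < m) :
    ∑ X : Finset (Fin m), (-1 : ℝ) ^ X.card * (correlationMatrix k (block w X) ^ j).trace = 0 := by
  rcases j with - | j
  · simpa using alternating_sum_card_block w hm
  set U := block w Finset.univ
  let A : Fin m → Matrix U U ℝ := fun i =>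
    correlationMatrix k U * Matrix.diagonal fun u : U => if (u : ℤ) ∈ strip w i then 1 else 0
  have hA : ∀ X : Finset (Fin m), (correlationMatrix k (block w X) ^ (j + 1)).trace
      = ((∑ i ∈ X, A i) ^ (j + 1)).trace := by
    intro X
    rw [trace_correlationMatrix_pow_succ k (s := block w X) (U := U)
      (Finset.biUnion_subset_biUnion_of_subset_left _ (Finset.subset_univ X)), ← Finset.mul_sum]
    congr 3
    ext u v
    rw [Matrix.sum_apply]
    simp only [Matrix.diagonal_apply, ite_mem_block]
    split_ifs <;> simp
  have h := congrArg Matrix.trace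
    (alternating_sum_pow_eq_zero A (j := j + 1) (by simpa using hj))
  rw [Matrix.trace_sum] at h
  simp only [hA]
  simp only [Matrix.trace_smul, Matrix.trace_zero] at h
  simpa using h

theorem multipartiteInfo_eq (α k : ℝ) :
    multipartiteInfo w α k
      = -∑ X : Finset (Fin m), (-1 : ℝ) ^ X.card * entropy α k (block w X) := by
  have h0 : entropy α k (block w ∅) = 0 := by
    unfold entropy
    have : IsEmpty (block w ∅ : Finset ℤ) := ⟨fun x => by simpa [block] using x.2⟩
    exact Finset.sum_eq_zero fun i _ => isEmptyElim i
  rw [multipartiteInfo, ← Finset.sum_neg_distrib,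
    ← Finset.add_sum_erase _ _ (Finset.mem_univ (∅ : Finset (Fin m))), h0]
  simp only [mul_zero, neg_zero, zero_add]
  exact Finset.sum_congr rfl fun X _ => by rw [pow_succ]; ring

end Strips

/-! ### The entropy functions near zero -/

/-- Taylor expansion of an analytic function with the first nonvanishing coefficient of degree at
least `m` singled out. -/
theorem exists_expansion_of_analyticAt {h : ℝ → ℝ} (hh : AnalyticAt ℝ h 0) (m : ℕ)
    (hpoly : ¬ ∃ q : Polynomial ℝ, ∀ᶠ t in 𝓝 0, h t = q.eval t) :
    ∃ (β : ℕ) (b : ℕ → ℝ) (a : ℝ), m ≤ β ∧ a ≠ 0 ∧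
      (fun t => h t - ∑ j ∈ Finset.range m, b j * t ^ j - a * t ^ β) =o[𝓝 0] fun t => t ^ β := by
  -- `g j` is the power series of `h` shifted by `j` places, so `g j 0` is the `j`-th coefficient.
  let g : ℕ → ℝ → ℝ := fun j => j.rec h fun _ f => dslope f 0
  have hg : ∀ j, AnalyticAt ℝ (g j) 0 := by
    intro j
    induction j with
    | zero => exact hh
    | succ j ih =>
      obtain ⟨p, hp⟩ := ih
      exact ⟨_, hp.has_fpower_series_dslope_fslope⟩
  have taylor : ∀ t, h t = ∑ j ∈ Finset.range m, g j 0 * t ^ j + t ^ m * g m t := by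
    intro t
    induction m with
    | zero => simp [g]
    | succ m ih =>
      have e : t * g (m + 1) t = g m t - g m 0 := by
        simpa using sub_smul_dslope (g m) 0 t
      rw [ih, Finset.sum_range_succ, pow_succ]
      linear_combination -(t ^ m) * e
  have hne : ¬ ∀ᶠ t in 𝓝 0, g m t = 0 := by
    intro h0
    refine hpoly ⟨∑ j ∈ Finset.range m, Polynomial.C (g j 0) * Polynomial.X ^ j, ?_⟩
    filter_upwards [h0] with t ht
    rw [taylor t, ht]
    simp [Polynomial.eval_finsetSum]
  obtain ⟨N, f, hf, hf0, hfe⟩ := (hg m).exists_eventuallyEq_pow_smul_nonzero_iff.mpr hne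
  refine ⟨m + N, fun j => g j 0, f 0, by omega, hf0, ?_⟩
  have hlim : (fun t => f t - f 0) =o[𝓝 0] fun _ => (1 : ℝ) := by
    rw [isLittleO_one_iff]
    simpa using hf.continuousAt.tendsto.sub_const (f 0)
  have := (isBigO_refl (fun t : ℝ => t ^ (m + N)) (𝓝 0)).mul_isLittleO hlim
  refine this.congr' ?_ (by simp)
  filter_upwards [hfe] with t ht
  rw [taylor t, ht]
  simp only [sub_zero, smul_eq_mul]
  ring

/-- If `log (t ^ n + (1 - t) ^ n)` were a polynomial near `0`, the polynomial `t ^ n + (1 - t) ^ n`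
would divide its own nonzero derivative. -/
theorem entropyFn_not_polynomial {n : ℕ} (hn : 2 ≤ n) :
    ¬ ∃ q : Polynomial ℝ, ∀ᶠ t in 𝓝 0, entropyFn n t = q.eval t := by
  rintro ⟨q, hq⟩
  have hn1 : (n : ℝ) ≠ 1 := by
    have : n ≠ 1 := by omega
    exact_mod_cast this
  have hn1' : (1 - n : ℝ) ≠ 0 := sub_ne_zero.mpr hn1.symm
  let p : Polynomial ℝ := Polynomial.X ^ n + (1 - Polynomial.X) ^ n
  have hp : ∀ t, p.eval t = t ^ n + (1 - t) ^ n := by intro t; simp [p]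
  have hp0 : p.eval 0 = 1 := by rw [hp]; simp [show n ≠ 0 by omega]
  have hdp0 : p.derivative.eval 0 ≠ 0 := by
    have : n - 1 ≠ 0 := by omega
    have : n ≠ 0 := by omega
    simp [p, Polynomial.derivative_pow, *]
  have hpos : ∀ᶠ t in 𝓝 (0 : ℝ), p.eval t ≠ 0 :=
    p.continuous.continuousAt.eventually_ne (by rw [hp0]; exact one_ne_zero)
  have key : ∀ᶠ t in 𝓝 (0 : ℝ), p.derivative.eval t
      = (Polynomial.C (1 - n : ℝ) * q.derivative * p).eval t := by
    filter_upwards [hq.eventually_nhds, hpos] with t ht hpt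
    have h1 : HasDerivAt (fun t => Real.log (p.eval t)) (p.derivative.eval t / p.eval t) t :=
      (p.hasDerivAt t).log hpt
    have h2 : HasDerivAt (fun t => (1 - n : ℝ) * q.eval t) ((1 - n) * q.derivative.eval t) t :=
      (q.hasDerivAt t).const_mul _
    have h3 : (fun t => Real.log (p.eval t)) =ᶠ[𝓝 t] fun t => (1 - n : ℝ) * q.eval t := by
      filter_upwards [ht] with x hx
      rw [← hx, entropyFn, if_neg hn1, hp]
      simp only [Real.rpow_natCast]
      field_simp
    have h4 := h1.unique (h2.congr_of_eventuallyEq h3)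
    rw [div_eq_iff hpt] at h4
    simpa using h4
  have heq : p.derivative = Polynomial.C (1 - n : ℝ) * q.derivative * p :=
    Polynomial.eq_of_infinite_eval_eq _ _ (infinite_of_mem_nhds 0 key)
  have hd : p.derivative ≠ 0 := fun h => hdp0 (by simp [h])
  have hp' : p ≠ 0 := fun h => hd (by simp [h])
  exact absurd (Polynomial.degree_le_of_dvd (Dvd.intro_left _ heq.symm) hd)
    (not_le.mpr (Polynomial.degree_derivative_lt hp'))

theorem analyticAt_entropyFn {n : ℕ} (hn : 2 ≤ n) : AnalyticAt ℝ (entropyFn n) 0 := by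
  have hn1 : (n : ℝ) ≠ 1 := by
    have : n ≠ 1 := by omega
    exact_mod_cast this
  have e : entropyFn n = fun t : ℝ => Real.log (t ^ n + (1 - t) ^ n) / (1 - n) := by
    ext t
    rw [entropyFn, if_neg hn1]
    simp only [Real.rpow_natCast]
  rw [e]
  have : AnalyticAt ℝ (fun t : ℝ => t ^ n + (1 - t) ^ n) 0 := by fun_prop
  exact (this.log (by simp [show n ≠ 0 by omega])).div_const

theorem entropyFn_one_expansion :
    (fun t => entropyFn 1 t - (-(t * Real.log t) + t)) =o[𝓝 0] fun t : ℝ => t := by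
  have h1 : HasDerivAt (fun t : ℝ => 1 - t) (-1) 0 := by
    simpa using (hasDerivAt_id (0 : ℝ)).const_sub 1
  -- The expansion is the linearization of `(1 - t) log (1 - t)` at `0`.
  have h2 : HasDerivAt (fun t : ℝ => (1 - t) * Real.log (1 - t)) (-1) 0 := by
    exact (h1.fun_mul (h1.log (by norm_num))).congr_deriv (by norm_num)
  have h3 := h2.isLittleO
  refine (h3.neg_left).congr (fun t => ?_) fun t => by simp
  simp [entropyFn]
  ring

/-! ### The correlation matrix at small Fermi momentum -/

theorem tendsto_sineKernel_div (x y : ℤ) :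
    Tendsto (fun k => sineKernel k x y / (k / Real.pi)) (𝓝[>] 0) (𝓝 1) := by
  have hpi := Real.pi_ne_zero
  by_cases h : x = y
  · refine tendsto_const_nhds.congr' ?_
    filter_upwards [self_mem_nhdsWithin] with k hk
    have hk : k ≠ 0 := ne_of_gt hk
    rw [sineKernel, if_pos h, div_self (by positivity)]
  · have hd : (x : ℝ) - y ≠ 0 := sub_ne_zero.mpr (by exact_mod_cast h)
    have h1 : Tendsto (fun k : ℝ => Real.sinc (k * (x - y))) (𝓝[>] 0) (𝓝 1) := by
      have : Continuous fun k : ℝ => Real.sinc (k * (x - y)) :=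
        Real.continuous_sinc.comp (by fun_prop)
      simpa using (this.tendsto 0).mono_left nhdsWithin_le_nhds
    refine h1.congr' ?_
    filter_upwards [self_mem_nhdsWithin] with k hk
    have hk : k ≠ 0 := ne_of_gt hk
    rw [sineKernel, if_neg h, Real.sinc_of_ne_zero (mul_ne_zero hk hd)]
    field_simp

theorem trace_ones_pow_succ {n : Type*} [Fintype n] [DecidableEq n] (j : ℕ) :
    ((Matrix.of fun _ _ => 1 : Matrix n n ℝ) ^ (j + 1)).trace = (Fintype.card n : ℝ) ^ (j + 1) := by
  have h : ∀ l : ℕ, (Matrix.of fun _ _ => 1 : Matrix n n ℝ) ^ (l + 1)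
      = (Fintype.card n : ℝ) ^ l • (Matrix.of fun _ _ => 1 : Matrix n n ℝ) := by
    intro l
    induction l with
    | zero => simp
    | succ l ih =>
      rw [pow_succ, ih]
      ext x y
      simp [Matrix.mul_apply, pow_succ, mul_comm]
  rw [h]
  simp [Matrix.trace, pow_succ, mul_comm]

/-- After rescaling, the correlation matrix converges to the all-ones matrix. -/
theorem tendsto_trace_pow_div (s : Finset ℤ) {j : ℕ} (hj : 1 ≤ j) :
    Tendsto (fun k => (correlationMatrix k s ^ j).trace / (k / Real.pi) ^ j) (𝓝[>] 0)
      (𝓝 ((s.card : ℝ) ^ j)) := by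
  obtain ⟨j, rfl⟩ := Nat.exists_eq_add_of_le' hj
  have h1 : Tendsto (fun k => (k / Real.pi)⁻¹ • correlationMatrix k s) (𝓝[>] 0)
      (𝓝 (Matrix.of fun _ _ => 1 : Matrix s s ℝ)) := by
    refine tendsto_pi_nhds.mpr fun x => tendsto_pi_nhds.mpr fun y => ?_
    refine (tendsto_sineKernel_div x y).congr fun k => ?_
    rw [div_eq_inv_mul]; rfl
  have h2 : Continuous fun M : Matrix s s ℝ => (M ^ (j + 1)).trace :=
    Continuous.matrix_trace (continuous_pow (j + 1))
  have h3 := (h2.tendsto _).comp h1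
  rw [trace_ones_pow_succ, Fintype.card_coe] at h3
  refine h3.congr fun k => ?_
  simp only [Function.comp_apply, smul_pow, Matrix.trace_smul, smul_eq_mul]
  rw [inv_pow, ← div_eq_inv_mul]

theorem trace_correlationMatrix (k : ℝ) (s : Finset ℤ) :
    (correlationMatrix k s).trace = s.card * (k / Real.pi) := by
  simp [Matrix.trace, correlationMatrix, sineKernel]

theorem isLittleO_trace_pow_sub (s : Finset ℤ) {j : ℕ} (hj : 1 ≤ j) :
    (fun k => (correlationMatrix k s ^ j).trace - (s.card : ℝ) ^ j * (k / Real.pi) ^ j)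
      =o[𝓝[>] 0] fun k => k ^ j := by
  have hpi := Real.pi_ne_zero
  have h1 := (tendsto_trace_pow_div s hj).sub_const ((s.card : ℝ) ^ j)
  rw [sub_self, ← isLittleO_one_iff ℝ] at h1
  have h2 : (fun k : ℝ => (k / Real.pi) ^ j) =O[𝓝[>] 0] fun k => k ^ j := by
    refine (isBigO_const_mul_self ((Real.pi ^ j)⁻¹) (fun k : ℝ => k ^ j) _).congr_left fun k => ?_
    rw [div_pow]; ring
  refine (h1.mul_isBigO h2).congr' ?_ (by simp)
  filter_upwards [self_mem_nhdsWithin] with k hk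
  have hk : k ≠ 0 := ne_of_gt hk
  field_simp

theorem isBigO_eigenvalues (s : Finset ℤ) (i : s) :
    (fun k => (correlationMatrix_isHermitian k s).eigenvalues i) =O[𝓝[>] 0] fun k => k := by
  have hpi := Real.pi_ne_zero
  have h1 : (fun k => (correlationMatrix k s ^ 2).trace) =O[𝓝[>] 0] fun k => k ^ 2 := by
    have h2 := (isBigO_const_mul_self ((s.card : ℝ) ^ 2 / Real.pi ^ 2) (fun k : ℝ => k ^ 2) (𝓝[>] 0))
    refine ((isLittleO_trace_pow_sub s one_le_two).isBigO.add h2).congr_left fun k => ?_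
    field_simp
    ring
  -- The square of one eigenvalue is at most the trace of the square.
  refine IsBigO.of_pow two_ne_zero (IsBigO.trans (IsBigO.of_bound' ?_) h1)
  refine Eventually.of_forall fun k => ?_
  simp only [Pi.pow_apply]
  rw [trace_pow_eq_sum_eigenvalues_pow (correlationMatrix_isHermitian k s),
    Real.norm_of_nonneg (sq_nonneg _), Real.norm_of_nonneg (Finset.sum_nonneg fun _ _ => sq_nonneg _)]
  exact Finset.single_le_sum (f := fun i => (correlationMatrix_isHermitian k s).eigenvalues i ^ 2)
    (fun _ _ => sq_nonneg _) (Finset.mem_univ i)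

theorem tendsto_eigenvalues (s : Finset ℤ) (i : s) :
    Tendsto (fun k => (correlationMatrix_isHermitian k s).eigenvalues i) (𝓝[>] 0) (𝓝 0) :=
  (isBigO_eigenvalues s i).trans_tendsto (tendsto_id.mono_left nhdsWithin_le_nhds)

/-- A continuous function vanishing at `0` and `D` is small wherever `u (u - D)` is small. -/
theorem tendsto_zero_of_mul_sub_tendsto_zero {α : Type*} {l : Filter α} {ψ : ℝ → ℝ}
    (hψ : Continuous ψ) {D : ℝ} (h0 : ψ 0 = 0) (hD : ψ D = 0) {u : α → ℝ}
    (hu : Tendsto (fun x => u x * (u x - D)) l (𝓝 0)) :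
    Tendsto (fun x => ψ (u x)) l (𝓝 0) := by
  rw [Metric.tendsto_nhds]
  intro ε hε
  obtain ⟨δ₀, hδ₀, H₀⟩ := Metric.continuousAt_iff.mp (hψ.continuousAt (x := 0)) ε hε
  obtain ⟨δ₁, hδ₁, H₁⟩ := Metric.continuousAt_iff.mp (hψ.continuousAt (x := D)) ε hε
  rw [h0] at H₀
  rw [hD] at H₁
  filter_upwards [Metric.tendsto_nhds.mp hu (δ₀ * δ₁) (mul_pos hδ₀ hδ₁)] with x hx
  rw [Real.dist_eq, sub_zero, abs_mul] at hx
  rcases lt_or_ge |u x| δ₀ with h | h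
  · exact H₀ (by rwa [Real.dist_eq, sub_zero])
  · refine H₁ ?_
    rw [Real.dist_eq]
    by_contra! h'
    exact absurd hx (not_lt.mpr (mul_le_mul h h' hδ₁.le (abs_nonneg _)))

/-- The rescaled eigenvalues approach the roots `0` and `|s|` of `μ (μ - |s|)`, since the trace of
the square of this polynomial of the rescaled matrix tends to zero. No labelling of the eigenvalues
by size is needed. -/
theorem tendsto_rescaled_eigenvalues (s : Finset ℤ) (i : s) :
    Tendsto (fun k => (correlationMatrix_isHermitian k s).eigenvalues i / (k / Real.pi) *
      ((correlationMatrix_isHermitian k s).eigenvalues i / (k / Real.pi) - s.card))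
      (𝓝[>] 0) (𝓝 0) := by
  set μ : ℝ → s → ℝ := fun k i => (correlationMatrix_isHermitian k s).eigenvalues i / (k / Real.pi)
  have hμ : ∀ j, 1 ≤ j → Tendsto (fun k => ∑ i, μ k i ^ j) (𝓝[>] 0) (𝓝 ((s.card : ℝ) ^ j)) := by
    intro j hj
    refine (tendsto_trace_pow_div s hj).congr fun k => ?_
    rw [trace_pow_eq_sum_eigenvalues_pow (correlationMatrix_isHermitian k s), Finset.sum_div]
    exact Finset.sum_congr rfl fun i _ => (div_pow _ _ _).symm
  have hsum : Tendsto (fun k => ∑ i, (μ k i * (μ k i - s.card)) ^ 2) (𝓝[>] 0) (𝓝 0) := by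
    have h := ((hμ 4 (by norm_num)).sub ((hμ 3 (by norm_num)).const_mul (2 * (s.card : ℝ)))).add
      ((hμ 2 (by norm_num)).const_mul ((s.card : ℝ) ^ 2))
    have e : (s.card : ℝ) ^ 4 - 2 * s.card * s.card ^ 3 + s.card ^ 2 * s.card ^ 2 = 0 := by ring
    rw [e] at h
    refine h.congr fun k => ?_
    rw [Finset.mul_sum, Finset.mul_sum, ← Finset.sum_sub_distrib, ← Finset.sum_add_distrib]
    exact Finset.sum_congr rfl fun i _ => by ring
  have hsq : Tendsto (fun k => (μ k i * (μ k i - s.card)) ^ 2) (𝓝[>] 0) (𝓝 0) :=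
    squeeze_zero (fun k => sq_nonneg _) (fun k => Finset.single_le_sum
      (f := fun i => (μ k i * (μ k i - s.card)) ^ 2) (fun _ _ => sq_nonneg _) (Finset.mem_univ i))
      hsum
  have habs := hsq.sqrt
  simp only [Real.sqrt_sq_eq_abs, Real.sqrt_zero] at habs
  exact (tendsto_zero_iff_abs_tendsto_zero _).mpr habs

/-! ### Asymptotics of the entropies -/

/-- Writing an eigenvalue as `(k / π) μ`, the term `-λ log λ` splits into `-λ log (k / π)`, whose sum
is proportional to `|s|`, and `-(k / π) μ log μ`, where `μ log μ` may be replaced by `μ log |s|` up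
to an error tending to zero. -/
theorem entropy_one_isLittleO (s : Finset ℤ) :
    (fun k => entropy 1 k s - ((s.card : ℝ) * (k / Real.pi - k / Real.pi * Real.log (k / Real.pi))
      - s.card * Real.log s.card * (k / Real.pi))) =o[𝓝[>] 0] fun k => k := by
  have hpi := Real.pi_ne_zero
  set lam : ℝ → s → ℝ := fun k i => (correlationMatrix_isHermitian k s).eigenvalues i with hlam
  -- `ψ` vanishes at both limit points `0` and `|s|` of the rescaled eigenvalues.
  set ψ : ℝ → ℝ := fun μ => μ * Real.log μ - μ * Real.log s.card with hψ
  have hψc : Continuous ψ := Real.continuous_mul_log.sub (by fun_prop)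
  have h1 : (fun k => ∑ i, ψ (lam k i / (k / Real.pi))) =o[𝓝[>] 0] fun _ => (1 : ℝ) := by
    rw [isLittleO_one_iff]
    have := tendsto_finsetSum Finset.univ fun i _ => tendsto_zero_of_mul_sub_tendsto_zero hψc
      (by simp [hψ]) (by simp [hψ]) (tendsto_rescaled_eigenvalues s i)
    simpa using this
  have h2 : (fun k => k / Real.pi * ∑ i, ψ (lam k i / (k / Real.pi))) =o[𝓝[>] 0] fun k => k := by
    have hk : (fun k : ℝ => k / Real.pi) =O[𝓝[>] 0] fun k => k :=
      (isBigO_const_mul_self (Real.pi⁻¹) (fun k : ℝ => k) _).congr_left fun k => by ring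
    simpa using hk.mul_isLittleO h1
  have h3 : (fun k => ∑ i, (entropyFn 1 (lam k i)
      - (-(lam k i * Real.log (lam k i)) + lam k i))) =o[𝓝[>] 0] fun k => k :=
    IsLittleO.fun_sum fun i _ => (entropyFn_one_expansion.comp_tendsto
      (tendsto_eigenvalues s i)).trans_isBigO (isBigO_eigenvalues s i)
  refine (h3.sub h2).congr' ?_ EventuallyEq.rfl
  filter_upwards [self_mem_nhdsWithin] with k hk
  have hk : 0 < k := hk
  have hρ : k / Real.pi ≠ 0 := by positivity
  have htr : ∑ i, lam k i = s.card * (k / Real.pi) := by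
    rw [← trace_correlationMatrix, ← pow_one (correlationMatrix k s),
      trace_pow_eq_sum_eigenvalues_pow (correlationMatrix_isHermitian k s)]
    simp [hlam]
  have hterm : ∀ i, k / Real.pi * ψ (lam k i / (k / Real.pi)) = lam k i * Real.log (lam k i)
      - lam k i * (Real.log (k / Real.pi) + Real.log s.card) := by
    intro i
    -- `log` is not multiplicative at `0`, where both sides vanish.
    by_cases h0 : lam k i = 0
    · simp [hψ, h0]
    · simp only [hψ]
      rw [Real.log_div h0 hρ]
      field_simp
      ring
  rw [Finset.mul_sum, ← Finset.sum_sub_distrib]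
  have hterm2 : ∀ i, entropyFn 1 (lam k i) - (-(lam k i * Real.log (lam k i)) + lam k i)
      - k / Real.pi * ψ (lam k i / (k / Real.pi)) = entropyFn 1 (lam k i)
      - lam k i * (1 - (Real.log (k / Real.pi) + Real.log s.card)) := by
    intro i; rw [hterm i]; ring
  simp only [hterm2]
  rw [Finset.sum_sub_distrib, ← Finset.sum_mul, htr]
  change entropy 1 k s - _ = _
  ring

theorem entropy_isLittleO_of_expansion (s : Finset ℤ) {α a : ℝ} {b : ℕ → ℝ} {m β : ℕ} (hβ : 1 ≤ β)
    (h : (fun t => entropyFn α t - ∑ j ∈ Finset.range m, b j * t ^ j - a * t ^ β)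
      =o[𝓝 0] fun t => t ^ β) :
    (fun k => entropy α k s - ∑ j ∈ Finset.range m, b j * (correlationMatrix k s ^ j).trace
      - a * (s.card : ℝ) ^ β * (k / Real.pi) ^ β) =o[𝓝[>] 0] fun k => k ^ β := by
  set lam : ℝ → s → ℝ := fun k i => (correlationMatrix_isHermitian k s).eigenvalues i with hlam
  have h1 : (fun k => ∑ i, (entropyFn α (lam k i) - ∑ j ∈ Finset.range m, b j * lam k i ^ j
      - a * lam k i ^ β)) =o[𝓝[>] 0] fun k => k ^ β :=
    IsLittleO.fun_sum fun i _ => (h.comp_tendsto (tendsto_eigenvalues s i)).trans_isBigO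
      ((isBigO_eigenvalues s i).pow β)
  refine (h1.add ((isLittleO_trace_pow_sub s hβ).const_mul_left a)).congr_left fun k => ?_
  have htr : ∀ j, ∑ i, lam k i ^ j = (correlationMatrix k s ^ j).trace := fun j =>
    (trace_pow_eq_sum_eigenvalues_pow (correlationMatrix_isHermitian k s) j).symm
  rw [Finset.sum_sub_distrib, Finset.sum_sub_distrib, Finset.sum_comm, ← Finset.mul_sum, htr]
  simp only [← Finset.mul_sum, htr]
  change entropy α k s - _ - _ + _ = _
  ring

/-! ### Asymptotics of the multipartite information -/

section Information

variable {m : ℕ} (w : Fin m → ℕ)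

/-- Only the coefficient `a t ^ β` of the entropy function contributes to the multipartite
information at order `k ^ β`. -/
theorem multipartiteInfo_isLittleO_of_expansion (hm : 2 ≤ m) {α a : ℝ} {b : ℕ → ℝ} {β : ℕ}
    (hβ : 1 ≤ β)
    (h : (fun t => entropyFn α t - ∑ j ∈ Finset.range m, b j * t ^ j - a * t ^ β)
      =o[𝓝 0] fun t => t ^ β) :
    (fun k => multipartiteInfo w α k
      - (-(a * ∑ X : Finset (Fin m), (-1) ^ X.card * (∑ i ∈ X, (w i : ℝ)) ^ β) / Real.pi ^ β)
        * k ^ β) =o[𝓝[>] 0] fun k => k ^ β := by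
  have h1 : (fun k => ∑ X : Finset (Fin m), (-(-1 : ℝ) ^ X.card) * (entropy α k (block w X)
      - ∑ j ∈ Finset.range m, b j * (correlationMatrix k (block w X) ^ j).trace
      - a * ((block w X).card : ℝ) ^ β * (k / Real.pi) ^ β)) =o[𝓝[>] 0] fun k => k ^ β :=
    IsLittleO.fun_sum fun X _ =>
      (entropy_isLittleO_of_expansion (block w X) hβ h).const_mul_left _
  refine h1.congr_left fun k => ?_
  have hzero : ∑ X : Finset (Fin m), (-1 : ℝ) ^ X.card *
      ∑ j ∈ Finset.range m, b j * (correlationMatrix k (block w X) ^ j).trace = 0 := by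
    simp only [Finset.mul_sum]
    rw [Finset.sum_comm]
    refine Finset.sum_eq_zero fun j hj => ?_
    have := alternating_sum_trace_pow_eq_zero w hm k (Finset.mem_range.mp hj)
    rw [← mul_zero (b j), ← this, Finset.mul_sum]
    exact Finset.sum_congr rfl fun X _ => by ring
  rw [multipartiteInfo_eq]
  simp only [mul_sub, neg_mul, Finset.sum_sub_distrib, Finset.sum_neg_distrib, hzero, card_block,
    Nat.cast_sum]
  rw [div_pow]
  have e : ∑ X : Finset (Fin m), (-1 : ℝ) ^ X.card * (a * (∑ i ∈ X, (w i : ℝ)) ^ β *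
      (k ^ β / Real.pi ^ β)) = a * (∑ X : Finset (Fin m), (-1) ^ X.card * (∑ i ∈ X, (w i : ℝ)) ^ β)
        / Real.pi ^ β * k ^ β := by
    rw [Finset.mul_sum, Finset.sum_div, Finset.sum_mul]
    exact Finset.sum_congr rfl fun X _ => by ring
  rw [e]
  ring

theorem multipartiteInfo_one_isLittleO (hm : 2 ≤ m) :
    (fun k => multipartiteInfo w 1 k
      - (∑ X : Finset (Fin m), (-1) ^ X.card * ((∑ i ∈ X, (w i : ℝ)) *
        Real.log (∑ i ∈ X, (w i : ℝ)))) / Real.pi * k) =o[𝓝[>] 0] fun k => k := by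
  have h1 := IsLittleO.fun_sum (s := (Finset.univ : Finset (Finset (Fin m)))) fun X _ =>
    (entropy_one_isLittleO (block w X)).const_mul_left (-(-1 : ℝ) ^ X.card)
  refine h1.congr_left fun k => ?_
  have hzero : ∑ X : Finset (Fin m), (-1 : ℝ) ^ X.card * (((block w X).card : ℝ) *
      (k / Real.pi - k / Real.pi * Real.log (k / Real.pi))) = 0 := by
    simp only [← mul_assoc]
    rw [← Finset.sum_mul, alternating_sum_card_block w hm, zero_mul]
  rw [multipartiteInfo_eq]
  simp only [mul_sub (-(-1 : ℝ) ^ _), neg_mul,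
    Finset.sum_sub_distrib, Finset.sum_neg_distrib, hzero]
  simp only [card_block, Nat.cast_sum]
  rw [Finset.sum_div, Finset.sum_mul]
  have e : ∀ X : Finset (Fin m), (-1 : ℝ) ^ X.card * ((∑ i ∈ X, (w i : ℝ)) *
      Real.log (∑ i ∈ X, (w i : ℝ))) / Real.pi * k = (-1 : ℝ) ^ X.card * ((∑ i ∈ X, (w i : ℝ)) *
      Real.log (∑ i ∈ X, (w i : ℝ)) * (k / Real.pi)) := fun X => by ring
  simp only [e]
  ring

/-- Passing from `k` to `z = k ℓ` in a power-law asymptotic. -/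
theorem infoOfZ_isEquivalent {ℓ α A : ℝ} {β : ℕ} (hℓ : 0 < ℓ) (hA : A ≠ 0)
    (h : (fun k => multipartiteInfo w α k - A * k ^ β) =o[𝓝[>] 0] fun k => k ^ β) :
    infoOfZ w ℓ α ~[𝓝[>] 0] fun z => A / ℓ ^ β * z ^ β := by
  have ht : Tendsto (fun z : ℝ => z / ℓ) (𝓝[>] 0) (𝓝[>] 0) := by
    refine tendsto_nhdsWithin_of_tendsto_nhds_of_eventually_within _ ?_ ?_
    · have : Continuous fun z : ℝ => z / ℓ := by fun_prop
      simpa using (this.tendsto 0).mono_left nhdsWithin_le_nhds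
    · filter_upwards [self_mem_nhdsWithin] with z hz
      exact div_pos hz hℓ
  have h2 := (h.comp_tendsto ht).trans_isBigO
    (isBigO_self_const_mul (c := A) hA (fun z => ((fun k : ℝ => k ^ β) ∘ fun z => z / ℓ) z) _)
  refine h2.congr (fun z => ?_) fun z => ?_
  · simp only [Function.comp_apply, infoOfZ, Pi.sub_apply, div_pow]; ring
  · simp only [Function.comp_apply, div_pow]; ring

end Information

end FreeFermion

theorem mainTheorem2 (m : ℕ) (hm : 3 ≤ m) :
    ∃ β : ℕ → ℕ, (∀ n : ℕ, 2 ≤ n → m ≤ β n) ∧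
      ∀ (w : Fin m → ℕ) (ℓ : ℝ), (∀ i, 0 < w i) → 0 < ℓ →
        ∃ (c : ℝ) (C : ℕ → ℝ), c ≠ 0 ∧
          (FreeFermion.infoOfZ w ℓ 1 ~[𝓝[>] 0] fun z => c * z) ∧
          (∀ n : ℕ, 2 ≤ n →
            C n ≠ 0 ∧
            (FreeFermion.infoOfZ w ℓ (n : ℝ) ~[𝓝[>] 0] fun z => C n * z ^ β n) ∧
            ((fun z => FreeFermion.infoOfZ w ℓ (n : ℝ) z / FreeFermion.infoOfZ w ℓ 1 z)
              ~[𝓝[>] 0] fun z => C n / c * z ^ (β n - 1)) ∧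
            Tendsto (fun z => FreeFermion.infoOfZ w ℓ (n : ℝ) z / FreeFermion.infoOfZ w ℓ 1 z)
              (𝓝[>] 0) (𝓝 0)) ∧
          (∀ (N : Finset ℕ), (∀ n ∈ N, 2 ≤ n) → ∀ Φ : (N → ℝ) → ℝ,
            (Φ =O[𝓝 0] fun x => x) →
            ((fun z : ℝ => Φ fun n => C n * z ^ β n) =o[𝓝[>] 0] FreeFermion.infoOfZ w ℓ 1) ∧
            ((fun z : ℝ => Φ fun n => FreeFermion.infoOfZ w ℓ ((n : ℕ) : ℝ) z)
              =o[𝓝[>] 0] FreeFermion.infoOfZ w ℓ 1)) := by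
  have hexp : ∀ n : ℕ, ∃ (β : ℕ) (b : ℕ → ℝ) (a : ℝ), 2 ≤ n → m ≤ β ∧ a ≠ 0 ∧
      (fun t => FreeFermion.entropyFn n t - ∑ j ∈ Finset.range m, b j * t ^ j - a * t ^ β)
        =o[𝓝 0] fun t => t ^ β := by
    intro n
    by_cases hn : 2 ≤ n
    · obtain ⟨β, b, a, h⟩ := FreeFermion.exists_expansion_of_analyticAt
        (FreeFermion.analyticAt_entropyFn hn) m (FreeFermion.entropyFn_not_polynomial hn)
      exact ⟨β, b, a, fun _ => h⟩
    · exact ⟨0, 0, 0, fun h => absurd h hn⟩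
  choose β b a hβ using hexp
  refine ⟨β, fun n hn => (hβ n hn).1, fun w ℓ hw hℓ => ?_⟩
  have hw' : ∀ i, (0 : ℝ) < w i := fun i => by exact_mod_cast hw i
  have : Nonempty (Fin m) := ⟨⟨0, by omega⟩⟩
  set B : ℝ := (∑ X : Finset (Fin m), (-1) ^ X.card * ((∑ i ∈ X, (w i : ℝ)) *
    Real.log (∑ i ∈ X, (w i : ℝ)))) / Real.pi with hB
  set A : ℕ → ℝ := fun n => -(a n * ∑ X : Finset (Fin m), (-1) ^ X.card *
    (∑ i ∈ X, (w i : ℝ)) ^ β n) / Real.pi ^ β n with hAdef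
  have hB0 : B ≠ 0 := div_ne_zero (FreeFermion.alternating_sum_mul_log_ne_zero _ hw'
    (by rw [Fintype.card_fin]; omega)) Real.pi_ne_zero
  have hA0 : ∀ n, 2 ≤ n → A n ≠ 0 := fun n hn =>
    div_ne_zero (neg_ne_zero.mpr (mul_ne_zero (hβ n hn).2.1
      (FreeFermion.alternating_sum_pow_ne_zero _ hw'
        (by rw [Fintype.card_fin]; exact (hβ n hn).1))))
      (pow_ne_zero _ Real.pi_ne_zero)
  have h1 : FreeFermion.infoOfZ w ℓ 1 ~[𝓝[>] 0] fun z => B / ℓ * z := by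
    simpa using FreeFermion.infoOfZ_isEquivalent (β := 1) w hℓ hB0
      (by simpa using FreeFermion.multipartiteInfo_one_isLittleO w (by omega))
  have hn : ∀ n : ℕ, 2 ≤ n →
      FreeFermion.infoOfZ w ℓ (n : ℝ) ~[𝓝[>] 0] fun z => A n / ℓ ^ β n * z ^ β n := fun n hn =>
    FreeFermion.infoOfZ_isEquivalent w hℓ (hA0 n hn)
      (FreeFermion.multipartiteInfo_isLittleO_of_expansion w (by omega)
        (by have := (hβ n hn).1; omega) (hβ n hn).2.2)
  have hc : B / ℓ ≠ 0 := div_ne_zero hB0 hℓ.ne'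
  have hzI : (fun z : ℝ => z) =O[𝓝[>] 0] FreeFermion.infoOfZ w ℓ 1 :=
    (isBigO_self_const_mul hc (fun z : ℝ => z) _).trans h1.symm.isBigO
  have hpow : ∀ n, 2 ≤ n → (fun z : ℝ => A n / ℓ ^ β n * z ^ β n) =o[𝓝[>] 0]
      FreeFermion.infoOfZ w ℓ 1 := fun n hn =>
    ((isLittleO_pow_id (by have := (hβ n hn).1; omega)).mono nhdsWithin_le_nhds
      |>.const_mul_left _).trans_isBigO hzI
  have hI0 : Tendsto (FreeFermion.infoOfZ w ℓ 1) (𝓝[>] 0) (𝓝 0) := by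
    refine h1.symm.tendsto_nhds ?_
    have : Continuous fun z : ℝ => B / ℓ * z := by fun_prop
    simpa using (this.tendsto 0).mono_left nhdsWithin_le_nhds
  have hΦ : ∀ (N : Finset ℕ) (Φ : (N → ℝ) → ℝ), (Φ =O[𝓝 0] fun x => x) →
      ∀ f : ℝ → N → ℝ, (∀ n, (fun z => f z n) =o[𝓝[>] 0] FreeFermion.infoOfZ w ℓ 1) →
        (fun z => Φ (f z)) =o[𝓝[>] 0] FreeFermion.infoOfZ w ℓ 1 := by
    intro N Φ hΦ f hf
    have hf' : f =o[𝓝[>] 0] FreeFermion.infoOfZ w ℓ 1 := isLittleO_pi.mpr hf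
    exact (hΦ.comp_tendsto (hf'.trans_tendsto hI0)).trans_isLittleO hf'
  refine ⟨B / ℓ, fun n => A n / ℓ ^ β n, hc, h1, fun n h2 => ⟨div_ne_zero (hA0 n h2)
    (pow_ne_zero _ hℓ.ne'), hn n h2, ?_, ?_⟩, fun N hN Φ hO => ⟨?_, ?_⟩⟩
  · refine ((hn n h2).div h1).congr_right ?_
    filter_upwards [self_mem_nhdsWithin] with z hz
    have hz : z ≠ 0 := ne_of_gt hz
    obtain ⟨r, hr⟩ : ∃ r, β n = r + 1 := ⟨β n - 1, by have := (hβ n h2).1; omega⟩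
    simp only [Pi.div_apply, hr, Nat.add_sub_cancel, pow_succ z]
    field_simp
  · exact ((hn n h2).isBigO.trans_isLittleO (hpow n h2)).tendsto_div_nhds_zero
  · exact hΦ N Φ hO _ fun n => hpow n (hN n n.2)
  · exact hΦ N Φ hO _ fun n => (hn n (hN n n.2)).isBigO.trans_isLittleO (hpow n (hN n n.2))
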